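/- Definitions. All topological groups are Hausdorff. A group $G$ is in SSGP$(0)$ if it is trivial; $G\in$ SSGP$(n+1)$ if for every neighborhood $U$ of $1_G$ there is a family $\mathcal H$ of subgroups of $G$, each contained in $U$, such that $K:=\overline{\langle\bigcup\mathcal H\rangle}$ is normal in $G$ and $G/K\in$ SSGP$(n)$. A norm on an abelian group $G$ is a function $\|\cdot\|:G\to[0,\infty)$ with $\|x\|=0$ iff $x=0$, $\|-x\|=\|x\|$ and $\|x+y\|\le\|x\|+\|y\|$ (not necessarily $\|kx\|=|k|\,\|x\|$); it gives $G$ the group topology of the metric $\|x-y\|$. Let $H=\mathbb Z^*_A$ be the group, under pointwise addition, of step functions $h:[0,1)\to\mathbb Z$ with finitely many steps $[a,b)$, $a,b\in A\cup\{1\}$, where $A$ is the set of dyadic rationals in $[0,1)$; put $\|h\|_H=\lambda(\{x:h(x)\ne0\})$, $\lambda$ being Lebesgue measure. For $m\ge0$ and $1\le t\le2^m$ let $e_{m,t}\in H$ be the indicator function of $[\frac{t-1}{2^m},\frac t{2^m})$, and for $r\ge0$ let $f_r=\sum_{i\ge1,\;2i-1\le2^r}e_{r,2i-1}$. Let $G$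 be an abelian group with norm $\|\cdot\|_G$. For each $m\in\mathbb Z$ let $(g_{m,t})_{t<\omega}$ be a list of the nonzero elements of $G$ of norm at most $2^{-m}$, and let $(m,t)\mapsto r(m,t)\in\mathbb N_0$ be injective on $\mathbb Z\times\mathbb N_0$. Let $S\subseteq H\oplus G$ consist of the elements $(p\,e_{m,t},0)$ ($m\ge0$, $1\le t\le2^m$, $p\in\mathbb Z\setminus\{0\}$), with provisional norm $\nu=\|p\,e_{m,t}\|_H=2^{-m}$, and the elements $(f_{r(m,t)},g_{m,t})$ ($m\in\mathbb Z$, $t<\omega$), with provisional norm $\nu=\|g_{m,t}\|_G$. For $x\in H\oplus G$ define $$\|x\|:=\inf\Big\{\sum_{i=1}^k|\alpha_i|\,\nu(s_i):\ x=\sum_{i=1}^k\alpha_is_i,\ s_i\in S,\ \alpha_i\in\mathbb Z,\ k<\omega\Big\}.\qquad(*)$$ Theorem. (1) For each $1\le n<\omega$ there is an abelian, countable, torsion-free, metrizable topological group that is in SSGP$(n)$ but not in SSGP$(n-1)$. (2) For each $0\le n<\omega$, SSGP$(n)\subseteq$ SSGP$(n+1)$, and the inclusion is proper. (3) $H$ is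 countable, torsion-free and nontrivial, $\|\cdot\|_H$ is a norm on it, and $H$ with this norm is in SSGP$(1)$. (4) Let $n\ge2$ and let $G$ be a countable torsion-free abelian group with a norm such that $G\in$ SSGP$(n-1)$ and $G\notin$ SSGP$(n-2)$. Then lists $g_{m,t}$ and injections $r$ as above exist, and for every choice of them: $S$ generates $H\oplus G$, $0\notin S$ and $\nu>0$ on $S$; $H\oplus G$ is countable and torsion-free; $(*)$ is a norm on $H\oplus G$; and $H\oplus G$ with this norm is in SSGP$(n)$ but not in SSGP$(n-1)$. (5) Consequently, starting with $G_1=H$ (with $\|\cdot\|_H$) and taking $G_{n+1}=H\oplus G_n$ with the norm $(*)$, for any choice of lists and injections at each step, one obtains for every $n\ge1$ a countable torsion-free abelian group $G_n$ with a norm, and $G_n\in$ SSGP$(n)$, $G_n\notin$ SSGP$(n-1)$. -/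

import Mathlib

open Set Topology MeasureTheory

universe u

/-- The classes `SSGP(n)`. `SSGP(0)` consists of the trivial groups; `G ∈ SSGP(n+1)` if every
neighbourhood `U` of `1` contains all members of a family `𝓗` of subgroups of `G` such that
`H`, the closure of the subgroup generated by `⋃ 𝓗`, is normal and `G ⧸ H ∈ SSGP(n)`.
It is meant for Hausdorff groups; `H` is closed, so all the quotients that occur are Hausdorff. -/
def SSGP : ℕ → (G : Type u) → [Group G] → [TopologicalSpace G] → [IsTopologicalGroup G] → Prop
  | 0, G, _, _, _ => Subsingleton G
  | n + 1, G, _, _, _ => ∀ U ∈ 𝓝 (1 : G), ∃ 𝓗 : Set (Subgroup G), (∀ K ∈ 𝓗, (K : Set G) ⊆ U) ∧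
      ∃ _ : (Subgroup.closure (⋃ K ∈ 𝓗, (K : Set G))).topologicalClosure.Normal,
        SSGP n (G ⧸ (Subgroup.closure (⋃ K ∈ 𝓗, (K : Set G))).topologicalClosure)

/-- Membership in `SSGP(n)` of the abelian group `G` with the metric topology of the group norm
`N`, that is, of the metric `N (x - y)`. A group norm need not satisfy `N (k • x) = |k| * N x`. -/
def NormSSGP (n : ℕ) {G : Type u} [AddCommGroup G] (N : AddGroupNorm G) : Prop :=
  letI : NormedAddCommGroup G := N.toNormedAddCommGroup
  SSGP n (Multiplicative G)

/-- The group of step functions `[0,1) → B` with finitely many steps `[a,b)`, whose end points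
lie in `A ∪ {1}`, under pointwise addition: `F` is the finite set of end points, and `f` takes
the same value at `x ≤ y` if no point of `F` lies in `(x,y]`. -/
def stepGroup (A : Set ℝ) (B : Type) [AddCommGroup B] : AddSubgroup (Ico (0 : ℝ) 1 → B) where
  carrier := {f | ∃ F : Finset ℝ, (F : Set ℝ) ⊆ A ∪ {1} ∧
    ∀ x y : Ico (0 : ℝ) 1, x ≤ y → (∀ c ∈ F, ¬ ((x : ℝ) < c ∧ c ≤ y)) → f x = f y}
  zero_mem' := ⟨∅, by simp, fun _ _ _ _ => rfl⟩
  add_mem' := by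
    classical
    rintro f g ⟨F, hF, hf⟩ ⟨F', hF', hg⟩
    refine ⟨F ∪ F', by rw [Finset.coe_union]; exact union_subset hF hF', fun x y hxy h => ?_⟩
    simp only [Pi.add_apply]
    rw [hf x y hxy fun c hc => h c (Finset.mem_union_left _ hc),
      hg x y hxy fun c hc => h c (Finset.mem_union_right _ hc)]
  neg_mem' := by
    rintro f ⟨F, hF, hf⟩
    exact ⟨F, hF, fun x y hxy h => by simp only [Pi.neg_apply, hf x y hxy h]⟩

/-- The dyadic rationals in `[0,1)`. -/
def dyadicPoints : Set ℝ := {x | x ∈ Ico (0 : ℝ) 1 ∧ ∃ m t : ℕ, x = t / 2 ^ m}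

/-- The group `H = ℤ*_A`, with `A` the set of dyadic rationals in `[0,1)`. -/
abbrev DyadicStep : Type := stepGroup dyadicPoints ℤ

/-- `‖h‖ = λ(Supp h)` on `H`, with `λ` the Lebesgue measure. -/
noncomputable def suppNorm (h : DyadicStep) : ℝ :=
  (volume (Subtype.val '' {x : Ico (0 : ℝ) 1 | h.1 x ≠ 0})).toReal

theorem dyadic_mem (m t : ℕ) (ht : t ≤ 2 ^ m) :
    (t : ℝ) / 2 ^ m ∈ dyadicPoints ∪ {1} := by
  rcases ht.lt_or_eq with h | h
  · refine Or.inl ⟨⟨by positivity, ?_⟩, m, t, rfl⟩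
    rw [div_lt_one (by positivity)]
    exact_mod_cast h
  · right
    subst h
    simp

open Classical in
/-- The element of `H` with value `1` on `[t/2^m, (t+1)/2^m)` and `0` elsewhere, for
`t = 0, …, 2^m - 1`. -/
noncomputable def dyadicUnit (m : ℕ) (t : Fin (2 ^ m)) : DyadicStep :=
  ⟨fun x => if (x : ℝ) ∈ Ico ((t : ℕ) / 2 ^ m : ℝ) (((t : ℕ) + 1 : ℕ) / 2 ^ m) then 1 else 0, by
    refine ⟨{((t : ℕ) / 2 ^ m : ℝ), (((t : ℕ) + 1 : ℕ) / 2 ^ m : ℝ)}, ?_, ?_⟩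
    · intro c hc
      simp only [Finset.coe_insert, Finset.coe_singleton, mem_insert_iff, mem_singleton_iff] at hc
      rcases hc with rfl | rfl
      · exact dyadic_mem m t t.2.le
      · exact dyadic_mem m (t + 1) t.2
    · intro x y hxy h
      have h1 := h _ (Finset.mem_insert_self _ _)
      have h2 := h _ (Finset.mem_insert_of_mem (Finset.mem_singleton_self _))
      have hxy' : (x : ℝ) ≤ y := hxy
      refine if_congr ?_ rfl rfl
      simp only [mem_Ico]
      constructor
      · rintro ⟨a, b⟩
        exact ⟨a.trans hxy', not_le.1 fun hc => h2 ⟨b, hc⟩⟩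
      · rintro ⟨a, b⟩
        exact ⟨not_lt.1 fun hc => h1 ⟨hc, a⟩, hxy'.trans_lt b⟩⟩

/-- The element `f_r` of `H`: the sum of the units of level `r` on every second dyadic interval,
starting with the leftmost one. -/
noncomputable def alternating (r : ℕ) : DyadicStep :=
  ∑ t : Fin (2 ^ r) with Even t.val, dyadicUnit r t

/-- The choices in the construction: for every `m : ℤ` a list `g m 0, g m 1, …` of the nonzero
elements of norm at most `1/2^m`, and an enumeration `r` of the pairs `(m,t)`. -/
structure IsListing {G : Type u} [AddCommGroup G] (N : AddGroupNorm G)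
    (g : ℤ → ℕ → G) (r : ℤ → ℕ → ℕ) : Prop where
  range_eq : ∀ m, range (g m) = {x : G | x ≠ 0 ∧ N x ≤ (2 : ℝ) ^ (-m)}
  injective : Function.Injective fun p : ℤ × ℕ => r p.1 p.2

/-- The generating set of `H ⊕ G`: the elements `(p • e, 0)`, `e` a unit of level `m` and `p ≠ 0`
an integer, and the elements `(f_{r(m,t)}, g m t)`. -/
def genSet {G : Type u} [AddCommGroup G] (g : ℤ → ℕ → G) (r : ℤ → ℕ → ℕ) :
    Set (DyadicStep × G) :=
  {s | ∃ (m : ℕ) (t : Fin (2 ^ m)) (p : ℤ), p ≠ 0 ∧ s = (p • dyadicUnit m t, 0)} ∪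
  {s | ∃ (m : ℤ) (t : ℕ), s = (alternating (r m t), g m t)}

open Classical in
/-- The provisional norm: `‖p • e‖` at the generators `(p • e, 0)` and `‖g m t‖` at the
generators `(f_{r(m,t)}, g m t)`, where `g m t ≠ 0`. Only its values on `genSet` matter. -/
noncomputable def provNorm {G : Type u} [AddCommGroup G] (N : AddGroupNorm G)
    (s : DyadicStep × G) : ℝ :=
  if s.2 = 0 then suppNorm s.1 else N s.2

/-- The function on `H ⊕ G` generated by the provisional norm: the infimum of
`∑ |α i| * ν (s i)` over all representations `x = ∑ α i • s i` with `s i` in the generating set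
and integers `α i`. -/
noncomputable def generatedNorm {G : Type u} [AddCommGroup G] (N : AddGroupNorm G)
    (g : ℤ → ℕ → G) (r : ℤ → ℕ → ℕ) (x : DyadicStep × G) : ℝ :=
  sInf {c : ℝ | ∃ (k : ℕ) (s : Fin k → DyadicStep × G) (α : Fin k → ℤ),
    (∀ i, s i ∈ genSet g r) ∧ x = ∑ i, α i • s i ∧ c = ∑ i, |(α i : ℝ)| * provNorm N (s i)}

/-- `IsStage n N`: the group `G` with the norm `N` is a possible `G_n` of the inductive
construction, where `G_1 = H` and `G_{n+1} = H ⊕ G_n` with the norm generated from the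
provisional norm. -/
inductive IsStage : ℕ → {G : Type} → [AddCommGroup G] → AddGroupNorm G → Prop
  | base (N : AddGroupNorm DyadicStep) (hN : ∀ h, N h = suppNorm h) : IsStage 1 N
  | step (n : ℕ) {G : Type} [AddCommGroup G] (N : AddGroupNorm G) (hN : IsStage n N)
      (g : ℤ → ℕ → G) (r : ℤ → ℕ → ℕ) (hgr : IsListing N g r)
      (N' : AddGroupNorm (DyadicStep × G)) (hN' : ∀ x, N' x = generatedNorm N g r x) :
      IsStage (n + 1) N'

/-! A step function `h` of level `m` is constant on the dyadic intervals of length `1/2^m`, while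
`f_r` with `r > m` takes the values `0` and `1` on halves of each of them. So if the largest index
`r` with a nonzero coefficient in a combination of the `f_r` exceeds `m`, then `h` minus the
combination is nonzero on a set of measure at least `1/2`. Hence a representation of `(h, x)` of
cost less than `1/2` uses only the finitely many generators `(f_r, g)` with `r ≤ m`, whose costs
are bounded below; this makes `(*)` definite. The same bound `r ≤ m` serves all multiples of `(h,
x)`, and only finitely many combinations of these generators cost less than `1/2`, so that a cyclic
subgroup inside the ball of radius `1/2` lies in `H ⊕ 0` when `G` is torsion-free.

Consequently the subgroups that a small neighbourhood admits die in `G`, while `H ⊕ 0` is generated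
by the arbitrarily small cyclic subgroups of dyadic units, and modulo `H ⊕ 0` each `x` in `G` has
the representative `(f_r, x)` of norm at most the norm of `x`. So `H ⊕ G` is in `SSGP(n + 1)` if
and only if `G` is in `SSGP(n)`.
-/

universe v

theorem sSup_image_map {G : Type u} [Group G] {G' : Type v} [Group G'] (φ : G →* G')
    (𝓗 : Set (Subgroup G)) : sSup (Subgroup.map φ '' 𝓗) = (sSup 𝓗).map φ := by
  rw [(Subgroup.gc_map_comap φ).l_sSup, sSup_image]

section TopologicalGroup

variable {G : Type u} [Group G] [TopologicalSpace G] [IsTopologicalGroup G]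
  {G' : Type v} [Group G'] [TopologicalSpace G'] [IsTopologicalGroup G']

theorem ssgp_succ_iff {n : ℕ} : SSGP (n + 1) G ↔ ∀ U ∈ 𝓝 (1 : G), ∃ 𝓗 : Set (Subgroup G),
    (∀ K ∈ 𝓗, (K : Set G) ⊆ U) ∧ ∃ _ : (sSup 𝓗).topologicalClosure.Normal,
      SSGP n (G ⧸ (sSup 𝓗).topologicalClosure) := by
  refine forall₂_congr fun U _ => exists_congr fun 𝓗 => and_congr_right fun _ => ?_
  have hsup : Subgroup.closure (⋃ K ∈ 𝓗, (K : Set G)) = sSup 𝓗 := by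
    simp only [Subgroup.closure_iUnion, Subgroup.closure_eq, sSup_eq_iSup]
  exact iff_of_eq (congrArg (fun K : Subgroup G => ∃ _ : K.topologicalClosure.Normal,
    SSGP n (G ⧸ K.topologicalClosure)) hsup)

theorem topologicalClosure_map_topologicalClosure {φ : G →* G'} (hφ : Continuous φ)
    (K : Subgroup G) :
    (K.topologicalClosure.map φ).topologicalClosure = (K.map φ).topologicalClosure :=
  SetLike.coe_injective (closure_image_closure hφ)

theorem SSGP.of_surjective (n : ℕ) : ∀ {G : Type u} [Group G] [TopologicalSpace G]
    [IsTopologicalGroup G] {G' : Type v} [Group G'] [TopologicalSpace G'] [IsTopologicalGroup G']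
    {φ : G →* G'}, Continuous φ → Function.Surjective φ → SSGP n G → SSGP n G' := by
  induction n with
  | zero =>
    intro G _ _ _ G' _ _ _ φ _ hsurj (h : Subsingleton G)
    exact hsurj.subsingleton
  | succ n ih =>
    intro G _ _ _ G' _ _ _ φ hφ hsurj h
    rw [ssgp_succ_iff] at h ⊢
    intro U hU
    obtain ⟨𝓗, h𝓗, hnormal, hquot⟩ := h _ (hφ.tendsto' 1 1 (map_one φ) hU)
    have hclosure := topologicalClosure_map_topologicalClosure hφ (sSup 𝓗)
    have hle : (sSup 𝓗).topologicalClosure ≤ ((sSup 𝓗).map φ).topologicalClosure.comap φ := by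
      rw [← Subgroup.map_le_iff_le_comap, ← hclosure]
      exact Subgroup.le_topologicalClosure _
    have hnormal' : ((sSup 𝓗).map φ).topologicalClosure.Normal := by
      have := hnormal.map φ hsurj
      rw [← hclosure]
      exact Subgroup.is_normal_topologicalClosure _
    refine ⟨Subgroup.map φ '' 𝓗, forall_mem_image.2 fun K hK => image_subset_iff.2 (h𝓗 K hK), ?_⟩
    rw [sSup_image_map]
    refine ⟨hnormal', ih (φ := QuotientGroup.map _ _ φ hle) ?_ ?_ hquot⟩
    · exact continuous_quot_lift _ (continuous_quotient_mk'.comp hφ)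
    · exact QuotientGroup.map_surjective_of_surjective _ _ φ
        ((QuotientGroup.mk_surjective).comp hsurj) hle

theorem SSGP.succ (n : ℕ) : ∀ {G : Type u} [Group G] [TopologicalSpace G] [IsTopologicalGroup G],
    SSGP n G → SSGP (n + 1) G := by
  induction n with
  | zero =>
    intro G _ _ _ (h : Subsingleton G)
    exact ssgp_succ_iff.2 fun U _ => ⟨∅, by simp,
      ⟨fun x hx g => by rwa [Subsingleton.elim (g * x * g⁻¹) x]⟩,
      QuotientGroup.mk_surjective.subsingleton⟩
  | succ n ih =>
    intro G _ _ _ h U hU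
    obtain ⟨𝓗, h𝓗, hnormal, hquot⟩ := h U hU
    exact ⟨𝓗, h𝓗, hnormal, ih hquot⟩

theorem SSGP.mono {m n : ℕ} (hmn : m ≤ n) (h : SSGP m G) : SSGP n G :=
  Nat.le_induction h (fun k _ => SSGP.succ k) n hmn

theorem SSGP.of_small_subgroups_le_ker [T2Space G'] {n : ℕ} {φ : G →* G'} (hφ : Continuous φ)
    (hsurj : Function.Surjective φ) {U : Set G} (hU : U ∈ 𝓝 (1 : G))
    (hker : ∀ K : Subgroup G, (K : Set G) ⊆ U → K ≤ φ.ker) (h : SSGP (n + 1) G) : SSGP n G' := by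
  obtain ⟨𝓗, h𝓗, hnormal, hquot⟩ := ssgp_succ_iff.1 h U hU
  have hle : (sSup 𝓗).topologicalClosure ≤ φ.ker :=
    Subgroup.topologicalClosure_minimal _ (sSup_le fun K hK => hker K (h𝓗 K hK))
      (isClosed_singleton.preimage hφ)
  have hcont : Continuous (QuotientGroup.lift _ φ hle) := continuous_quot_lift _ hφ
  exact SSGP.of_surjective n hcont
    (QuotientGroup.lift_surjective_of_surjective _ φ hsurj hle) hquot

end TopologicalGroup

section NormedGroup

variable {A : Type u} {G : Type v}

theorem mem_nhds_one_multiplicative_iff [SeminormedAddCommGroup A] {U : Set (Multiplicative A)} :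
    U ∈ 𝓝 (1 : Multiplicative A) ↔ ∃ ε > 0, ∀ x : A, ‖x‖ < ε → Multiplicative.ofAdd x ∈ U :=
  (NormedAddGroup.nhds_zero_basis_norm_lt (E := A)).mem_iff

theorem continuous_toMultiplicative_of_norm_le [SeminormedAddCommGroup A]
    [SeminormedAddCommGroup G] {π : A →+ G} (hπ : ∀ a, ‖π a‖ ≤ ‖a‖) :
    Continuous (AddMonoidHom.toMultiplicative π) :=
  (AddMonoidHomClass.lipschitz_of_bound π 1 (by simpa using hπ)).continuous

theorem continuous_mk'_comp_of_norm_add_le [SeminormedAddCommGroup A] [SeminormedAddCommGroup G]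
    {ι : G →+ A} {K : Subgroup (Multiplicative A)}
    (h : ∀ y, ∃ a, Multiplicative.ofAdd a ∈ K ∧ ‖a + ι y‖ ≤ ‖y‖) :
    Continuous ((QuotientGroup.mk' K).comp (AddMonoidHom.toMultiplicative ι)) := by
  refine continuous_of_continuousAt_one _ fun V hV => ?_
  rw [map_one] at hV
  obtain ⟨ε, hε, hball⟩ := mem_nhds_one_multiplicative_iff.1
    (QuotientGroup.continuous_mk.tendsto' (1 : Multiplicative A) 1 rfl hV)
  refine Filter.mem_map.2 (mem_nhds_one_multiplicative_iff.2 ⟨ε, hε, fun y hy => ?_⟩)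
  obtain ⟨a, ha, hay⟩ := h y
  have hmk : QuotientGroup.mk' K (Multiplicative.ofAdd (a + ι y)) =
      QuotientGroup.mk' K (Multiplicative.ofAdd (ι y)) := by
    rw [ofAdd_add, map_mul, QuotientGroup.mk'_apply, (QuotientGroup.eq_one_iff _).2 ha,
      one_mul]
  change QuotientGroup.mk' K (Multiplicative.ofAdd (ι y)) ∈ V
  exact hmk ▸ hball _ (hay.trans_lt hy)

variable [AddCommGroup A] [AddCommGroup G]

theorem not_normSSGP_zero [Nontrivial A] (N : AddGroupNorm A) : ¬ NormSSGP 0 N :=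
  fun h : Subsingleton A => not_subsingleton A h

theorem NormSSGP.mono {m n : ℕ} (hmn : m ≤ n) {N : AddGroupNorm A} (h : NormSSGP m N) :
    NormSSGP n N := by
  let _ : NormedAddCommGroup A := N.toNormedAddCommGroup
  exact SSGP.mono hmn h

theorem NormSSGP.of_small_zmultiples {n : ℕ} {N' : AddGroupNorm A} {N : AddGroupNorm G}
    {π : A →+ G} (hπ : Function.Surjective π) (hle : ∀ a, N (π a) ≤ N' a) {ε : ℝ} (hε : 0 < ε)
    (hker : ∀ a, (∀ k : ℤ, N' (k • a) < ε) → π a = 0) (h : NormSSGP (n + 1) N') :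
    NormSSGP n N := by
  let _ : NormedAddCommGroup A := N'.toNormedAddCommGroup
  let _ : NormedAddCommGroup G := N.toNormedAddCommGroup
  have hball : {x : Multiplicative A | N' x.toAdd < ε} ∈ 𝓝 1 :=
    mem_nhds_one_multiplicative_iff.2 ⟨ε, hε, fun _ hx => hx⟩
  exact SSGP.of_small_subgroups_le_ker (continuous_toMultiplicative_of_norm_le hle) hπ hball
    (fun K hK x hx => hker x.toAdd fun k => hK (zpow_mem hx k)) h

theorem NormSSGP.exists_ne_zero_lt {n : ℕ} {N : AddGroupNorm A} (h : NormSSGP (n + 1) N)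
    (h' : ¬ NormSSGP n N) {ε : ℝ} (hε : 0 < ε) : ∃ x, x ≠ 0 ∧ N x < ε := by
  by_contra! hdiscrete
  refine h' (h.of_small_zmultiples (π := AddMonoidHom.id A) Function.surjective_id
    (fun _ => le_rfl) hε fun a ha => ?_)
  by_contra ha0
  exact (hdiscrete a ha0).not_gt (by simpa using ha 1)

/-- The subgroup `L` is generated by cyclic subgroups that lie in arbitrarily small balls. -/
def HasSmallGenerators (N : AddGroupNorm A) (L : AddSubgroup A) : Prop :=
  ∀ ε > 0, ∃ T : Set A, (∀ t ∈ T, ∀ k : ℤ, N (k • t) < ε) ∧ AddSubgroup.closure T = L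

theorem HasSmallGenerators.map {N : AddGroupNorm A} {N' : AddGroupNorm G} {L : AddSubgroup A}
    (hL : HasSmallGenerators N L) {f : A →+ G} (hf : ∀ a, N' (f a) ≤ N a) :
    HasSmallGenerators N' (L.map f) := by
  intro ε hε
  obtain ⟨T, hT, rfl⟩ := hL ε hε
  refine ⟨f '' T, forall_mem_image.2 fun t ht k => ?_, (f.map_closure T).symm⟩
  rw [← map_zsmul]
  exact (hf _).trans_lt (hT t ht k)

theorem sSup_zpowers_ofAdd (T : Set A) :
    sSup ((fun t => Subgroup.zpowers (Multiplicative.ofAdd t)) '' T) =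
      AddSubgroup.toSubgroup (AddSubgroup.closure T) := by
  simp only [AddSubgroup.toSubgroup_closure, sSup_image, Subgroup.zpowers_eq_closure,
    ← Subgroup.closure_iUnion]
  congr 1
  ext x
  simp only [mem_iUnion, mem_singleton_iff, exists_prop, mem_preimage]
  exact ⟨fun ⟨_, ht, hx⟩ => hx ▸ ht, fun hx => ⟨_, hx, rfl⟩⟩

theorem NormSSGP.succ_of_hasSmallGenerators {n : ℕ} {N' : AddGroupNorm A} {N : AddGroupNorm G}
    {L : AddSubgroup A} (hL : HasSmallGenerators N' L) {ι : G →+ A} (hι : L ⊔ ι.range = ⊤)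
    (hshift : ∀ y, ∃ a ∈ L, N' (a + ι y) ≤ N y) (h : NormSSGP n N) : NormSSGP (n + 1) N' := by
  let _ : NormedAddCommGroup A := N'.toNormedAddCommGroup
  let _ : NormedAddCommGroup G := N.toNormedAddCommGroup
  refine ssgp_succ_iff.2 fun U hU => ?_
  obtain ⟨ε, hε, hball⟩ := mem_nhds_one_multiplicative_iff.1 hU
  obtain ⟨T, hT, hTL⟩ := hL ε hε
  refine ⟨(fun t => Subgroup.zpowers (Multiplicative.ofAdd t)) '' T, ?_, ?_⟩
  · rintro _ ⟨t, ht, rfl⟩ _ ⟨k, rfl⟩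
    exact hball (k • t) (hT t ht k)
  rw [sSup_zpowers_ofAdd, hTL]
  set K := (AddSubgroup.toSubgroup L).topologicalClosure
  have hLK : ∀ a ∈ L, Multiplicative.ofAdd a ∈ K :=
    fun a ha => Subgroup.le_topologicalClosure (AddSubgroup.toSubgroup L) ha
  have hcont := continuous_mk'_comp_of_norm_add_le (K := K) (ι := ι) fun y =>
    let ⟨a, ha, hay⟩ := hshift y
    ⟨a, hLK a ha, hay⟩
  refine ⟨inferInstance, SSGP.of_surjective n hcont (fun q => ?_) h⟩
  obtain ⟨x, rfl⟩ := QuotientGroup.mk_surjective q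
  obtain ⟨a, ha, _, ⟨y, rfl⟩, hx⟩ := AddSubgroup.mem_sup.1 (hι ▸ AddSubgroup.mem_top x.toAdd)
  refine ⟨Multiplicative.ofAdd y, QuotientGroup.eq.2 ?_⟩
  have hxy : x = Multiplicative.ofAdd a * Multiplicative.ofAdd (ι y) :=
    congrArg Multiplicative.ofAdd hx.symm
  simpa [hxy, mul_comm] using hLK a ha

end NormedGroup

section DyadicStep

/-- The position, among the `2 ^ m` dyadic intervals of level `m`, of the one that contains `x`. -/
noncomputable def dyadicIndex (m : ℕ) (x : Ico (0 : ℝ) 1) : Fin (2 ^ m) :=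
  ⟨⌊2 ^ m * (x : ℝ)⌋₊, by
    rw [Nat.floor_lt (mul_nonneg (by positivity) x.2.1)]
    push_cast
    exact mul_lt_of_lt_one_right (by positivity) x.2.2⟩

/-- The left end point of the dyadic interval of level `m` at position `t`. -/
noncomputable def dyadicPoint (m : ℕ) (t : Fin (2 ^ m)) : Ico (0 : ℝ) 1 :=
  ⟨(t : ℕ) / 2 ^ m, by positivity, by
    rw [div_lt_one (by positivity)]
    exact_mod_cast t.2⟩

theorem dyadicIndex_dyadicPoint (m : ℕ) (t : Fin (2 ^ m)) :
    dyadicIndex m (dyadicPoint m t) = t :=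
  Fin.ext <| (congrArg Nat.floor (mul_div_cancel₀ _ (by positivity))).trans (Nat.floor_natCast _)

theorem div_two_pow_le_iff_le_dyadicIndex {m k : ℕ} {x : Ico (0 : ℝ) 1} :
    (k / 2 ^ m : ℝ) ≤ x ↔ k ≤ dyadicIndex m x := by
  rw [div_le_iff₀' (by positivity), dyadicIndex,
    Nat.le_floor_iff (mul_nonneg (by positivity) x.2.1)]

theorem mem_Ico_iff_dyadicIndex_eq {m : ℕ} {t : Fin (2 ^ m)} {x : Ico (0 : ℝ) 1} :
    (x : ℝ) ∈ Ico ((t : ℕ) / 2 ^ m : ℝ) (((t : ℕ) + 1 : ℕ) / 2 ^ m) ↔ dyadicIndex m x = t := by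
  rw [mem_Ico, ← not_le, div_two_pow_le_iff_le_dyadicIndex, div_two_pow_le_iff_le_dyadicIndex,
    Fin.ext_iff]
  omega

theorem dyadicIndex_add_div (m k : ℕ) (x : Ico (0 : ℝ) 1) :
    (dyadicIndex (m + k) x : ℕ) / 2 ^ k = dyadicIndex m x := by
  have h := Nat.floor_div_natCast (2 ^ (m + k) * (x : ℝ)) (2 ^ k)
  rw [dyadicIndex, dyadicIndex, ← h, pow_add, Nat.cast_pow, Nat.cast_ofNat]
  congr 1
  field_simp

theorem dyadicIndex_eq_of_le {m M : ℕ} (hmM : m ≤ M) {x y : Ico (0 : ℝ) 1}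
    (h : dyadicIndex M x = dyadicIndex M y) : dyadicIndex m x = dyadicIndex m y := by
  obtain ⟨k, rfl⟩ := Nat.exists_eq_add_of_le hmM
  rw [Fin.ext_iff, ← dyadicIndex_add_div m k, h, dyadicIndex_add_div]

theorem dyadicUnit_apply (m : ℕ) (t : Fin (2 ^ m)) (x : Ico (0 : ℝ) 1) :
    (dyadicUnit m t).1 x = if dyadicIndex m x = t then 1 else 0 :=
  if_congr mem_Ico_iff_dyadicIndex_eq rfl rfl

theorem DyadicStep.sum_apply {ι : Type*} (s : Finset ι) (f : ι → DyadicStep)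
    (x : Ico (0 : ℝ) 1) : (∑ i ∈ s, f i).1 x = ∑ i ∈ s, (f i).1 x :=
  map_sum ((Pi.evalAddMonoidHom _ x).comp (stepGroup dyadicPoints ℤ).subtype) f s

theorem DyadicStep.zsmul_apply (a : ℤ) (h : DyadicStep) (x : Ico (0 : ℝ) 1) :
    (a • h).1 x = a * h.1 x :=
  zsmul_eq_mul _ _ |>.trans (by simp)

theorem alternating_apply (r : ℕ) (x : Ico (0 : ℝ) 1) :
    (alternating r).1 x = if Even (dyadicIndex r x : ℕ) then 1 else 0 := by
  simp only [alternating, DyadicStep.sum_apply, dyadicUnit_apply, Finset.sum_ite_eq,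
    Finset.mem_filter, Finset.mem_univ, true_and]

/-- The step functions that are constant on all dyadic intervals of level `m`. -/
def dyadicLevel (m : ℕ) : AddSubgroup DyadicStep where
  carrier := {h | h.1.FactorsThrough (dyadicIndex m)}
  zero_mem' _ _ _ := rfl
  add_mem' hf hg _ _ hxy := congrArg₂ (· + ·) (hf hxy) (hg hxy)
  neg_mem' hf _ _ hxy := congrArg Neg.neg (hf hxy)

theorem dyadicLevel_mono : Monotone dyadicLevel :=
  fun _ _ hmM _ hh _ _ hxy => hh (dyadicIndex_eq_of_le hmM hxy)

theorem dyadicUnit_mem_dyadicLevel (m : ℕ) (t : Fin (2 ^ m)) : dyadicUnit m t ∈ dyadicLevel m :=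
  fun x y hxy => by rw [dyadicUnit_apply, dyadicUnit_apply, hxy]

theorem alternating_mem_dyadicLevel (r : ℕ) : alternating r ∈ dyadicLevel r :=
  sum_mem fun t _ => dyadicUnit_mem_dyadicLevel r t

theorem DyadicStep.exists_mem_dyadicLevel (h : DyadicStep) : ∃ m, h ∈ dyadicLevel m := by
  obtain ⟨F, hF, hstep⟩ := h.2
  have hdyadic : ∀ c ∈ F, ∃ m k : ℕ, c = k / 2 ^ m := fun c hc =>
    (hF hc).elim (fun h => h.2) fun h => ⟨0, 1, by simpa using h⟩
  choose! m k hk using hdyadic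
  refine ⟨F.sup m, fun x y hxy => ?_⟩
  wlog hle : x ≤ y generalizing x y
  · exact (this y x hxy.symm (le_of_not_ge hle)).symm
  refine hstep x y hle fun c hc ⟨hxc, hcy⟩ => hxc.not_ge ?_
  rw [hk c hc, div_two_pow_le_iff_le_dyadicIndex] at hcy ⊢
  rwa [dyadicIndex_eq_of_le (Finset.le_sup hc) hxy]

theorem apply_dyadicPoint_dyadicIndex {m : ℕ} {h : DyadicStep} (hh : h ∈ dyadicLevel m)
    (x : Ico (0 : ℝ) 1) : h.1 (dyadicPoint m (dyadicIndex m x)) = h.1 x :=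
  hh (dyadicIndex_dyadicPoint m _)

theorem eq_sum_zsmul_dyadicUnit {m : ℕ} {h : DyadicStep} (hh : h ∈ dyadicLevel m) :
    h = ∑ t, h.1 (dyadicPoint m t) • dyadicUnit m t := by
  refine Subtype.ext (funext fun x => ?_)
  simp only [DyadicStep.sum_apply, DyadicStep.zsmul_apply, dyadicUnit_apply, mul_ite, mul_one,
    mul_zero, Finset.sum_ite_eq, Finset.mem_univ, if_true, apply_dyadicPoint_dyadicIndex hh]

instance DyadicStep.instCountable : Countable DyadicStep :=
  Function.Surjective.countable
    (f := fun p : Σ m : ℕ, (Fin (2 ^ m) → ℤ) => ∑ t, p.2 t • dyadicUnit p.1 t) fun h =>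
      let ⟨m, hm⟩ := h.exists_mem_dyadicLevel
      ⟨⟨m, fun t => h.1 (dyadicPoint m t)⟩, (eq_sum_zsmul_dyadicUnit hm).symm⟩

instance DyadicStep.instIsAddTorsionFree : IsAddTorsionFree DyadicStep :=
  Subtype.val_injective.isAddTorsionFree (stepGroup dyadicPoints ℤ).subtype

instance DyadicStep.instNontrivial : Nontrivial DyadicStep := by
  refine ⟨dyadicUnit 0 0, 0, fun h => ?_⟩
  have h1 := congrArg (fun h : DyadicStep => h.1 (dyadicPoint 0 0)) h
  rw [dyadicUnit_apply, dyadicIndex_dyadicPoint, if_pos rfl] at h1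
  exact one_ne_zero h1

theorem image_preimage_dyadicIndex (m : ℕ) (t : Fin (2 ^ m)) :
    (Subtype.val '' (dyadicIndex m ⁻¹' {t}) : Set ℝ) =
      Ico ((t : ℕ) / 2 ^ m : ℝ) (((t : ℕ) + 1 : ℕ) / 2 ^ m) := by
  refine Subset.antisymm ?_ fun x hx => ?_
  · rintro _ ⟨x, hx, rfl⟩
    exact mem_Ico_iff_dyadicIndex_eq.2 hx
  · have hx0 : 0 ≤ x := le_trans (by positivity) hx.1
    have hx1 : x < 1 := by
      refine hx.2.trans_le ((div_le_one (by positivity)).2 ?_)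
      exact_mod_cast t.2
    exact ⟨⟨x, hx0, hx1⟩, mem_Ico_iff_dyadicIndex_eq.1 hx, rfl⟩

theorem suppNorm_eq_card_div {m : ℕ} {h : DyadicStep} (hh : h ∈ dyadicLevel m) :
    suppNorm h = (Finset.univ.filter fun t => h.1 (dyadicPoint m t) ≠ 0).card / 2 ^ m := by
  set F := Finset.univ.filter fun t => h.1 (dyadicPoint m t) ≠ 0
  have hsupp : (Subtype.val '' {x | h.1 x ≠ 0} : Set ℝ) =
      ⋃ t ∈ F, Subtype.val '' (dyadicIndex m ⁻¹' {t}) := by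
    rw [← image_iUnion₂]
    congr 1
    ext x
    simp [F, apply_dyadicPoint_dyadicIndex hh]
  have hdisj : (F : Set (Fin (2 ^ m))).PairwiseDisjoint
      fun t => (Subtype.val '' (dyadicIndex m ⁻¹' {t}) : Set ℝ) := fun s _ t _ hst =>
    (disjoint_image_iff Subtype.val_injective).2 (pairwise_disjoint_fiber (dyadicIndex m) hst)
  simp only [image_preimage_dyadicIndex] at hsupp hdisj
  have hvol (t : Fin (2 ^ m)) :
      volume.real (Ico ((t : ℕ) / 2 ^ m : ℝ) (((t : ℕ) + 1 : ℕ) / 2 ^ m)) = 1 / 2 ^ m := by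
    rw [Real.volume_real_Ico_of_le (by gcongr; simp)]
    push_cast
    ring
  change volume.real _ = _
  rw [hsupp, measureReal_biUnion_finset hdisj (fun _ _ => measurableSet_Ico)
    fun _ _ => measure_Ico_lt_top.ne]
  simp only [hvol, Finset.sum_const, nsmul_eq_mul, mul_one_div]

theorem suppNorm_zsmul_dyadicUnit {m : ℕ} (t : Fin (2 ^ m)) {p : ℤ} (hp : p ≠ 0) :
    suppNorm (p • dyadicUnit m t) = 1 / 2 ^ m := by
  rw [suppNorm_eq_card_div (zsmul_mem (dyadicUnit_mem_dyadicLevel m t) p)]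
  simp [DyadicStep.zsmul_apply, dyadicUnit_apply, dyadicIndex_dyadicPoint, hp, Finset.filter_eq']

theorem suppNorm_add_le (h k : DyadicStep) : suppNorm (h + k) ≤ suppNorm h + suppNorm k := by
  obtain ⟨m, hm⟩ := h.exists_mem_dyadicLevel
  obtain ⟨n, hn⟩ := k.exists_mem_dyadicLevel
  replace hm := dyadicLevel_mono (le_max_left m n) hm
  replace hn := dyadicLevel_mono (le_max_right m n) hn
  rw [suppNorm_eq_card_div (add_mem hm hn), suppNorm_eq_card_div hm, suppNorm_eq_card_div hn,
    ← add_div]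
  gcongr
  norm_cast
  refine (Finset.card_le_card fun t ht => ?_).trans (Finset.card_union_le _ _)
  simp only [Finset.mem_union, Finset.mem_filter, Finset.mem_univ, true_and] at ht ⊢
  contrapose! ht
  exact (congrArg₂ (· + ·) ht.1 ht.2).trans (add_zero 0)

theorem suppNorm_eq_zero {h : DyadicStep} : suppNorm h = 0 ↔ h = 0 := by
  refine ⟨fun h0 => ?_, fun h0 => by simp [suppNorm, h0]⟩
  obtain ⟨m, hm⟩ := h.exists_mem_dyadicLevel
  simp only [suppNorm_eq_card_div hm, div_eq_zero_iff, Nat.cast_eq_zero, Finset.card_eq_zero,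
    Finset.filter_eq_empty_iff, pow_eq_zero_iff', OfNat.ofNat_ne_zero, false_and, or_false,
    Finset.mem_univ, not_not, forall_const] at h0
  rw [eq_sum_zsmul_dyadicUnit hm]
  exact Finset.sum_eq_zero fun t _ => by rw [h0, zero_zsmul]

/-- The norm `h ↦ λ(Supp h)` on the group of dyadic step functions. -/
noncomputable def suppGroupNorm : AddGroupNorm DyadicStep where
  toFun := suppNorm
  map_zero' := suppNorm_eq_zero.2 rfl
  add_le' := suppNorm_add_le
  neg' h := by simp [suppNorm]
  eq_zero_of_map_eq_zero' _ := suppNorm_eq_zero.1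

theorem suppNorm_nonneg (h : DyadicStep) : 0 ≤ suppNorm h :=
  ENNReal.toReal_nonneg

theorem le_suppNorm_of_forall_zsmul_dyadicUnit {p : AddGroupSeminorm DyadicStep}
    (hp : ∀ (m : ℕ) (t : Fin (2 ^ m)) (k : ℤ), k ≠ 0 →
      p (k • dyadicUnit m t) ≤ suppNorm (k • dyadicUnit m t)) (h : DyadicStep) :
    p h ≤ suppNorm h := by
  obtain ⟨m, hm⟩ := h.exists_mem_dyadicLevel
  have hterm (t : Fin (2 ^ m)) : p (h.1 (dyadicPoint m t) • dyadicUnit m t) ≤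
      if h.1 (dyadicPoint m t) ≠ 0 then 1 / 2 ^ m else 0 := by
    split_ifs with ht
    · exact (hp m t _ ht).trans_eq (suppNorm_zsmul_dyadicUnit t ht)
    · rw [of_not_not ht, zero_zsmul, map_zero]
  calc p h = p (∑ t, h.1 (dyadicPoint m t) • dyadicUnit m t) := by
        rw [← eq_sum_zsmul_dyadicUnit hm]
    _ ≤ ∑ t, p (h.1 (dyadicPoint m t) • dyadicUnit m t) :=
        Finset.le_sum_of_subadditive p (map_zero p).le (map_add_le_add p) _ _
    _ ≤ ∑ t, if h.1 (dyadicPoint m t) ≠ 0 then 1 / 2 ^ m else 0 :=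
        Finset.sum_le_sum fun t _ => hterm t
    _ = suppNorm h := by
        rw [suppNorm_eq_card_div hm, ← Finset.sum_filter, Finset.sum_const, nsmul_eq_mul,
          mul_one_div]

theorem closure_dyadicUnit_eq_top (M : ℕ) :
    AddSubgroup.closure (⋃ m ≥ M, range (dyadicUnit m)) = ⊤ := by
  refine (AddSubgroup.eq_top_iff' _).2 fun h => ?_
  obtain ⟨m, hm⟩ := h.exists_mem_dyadicLevel
  rw [eq_sum_zsmul_dyadicUnit (dyadicLevel_mono (le_max_left m M) hm)]
  exact sum_mem fun t _ => zsmul_mem (AddSubgroup.subset_closure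
    (mem_iUnion₂.2 ⟨_, le_max_right m M, mem_range_self t⟩)) _

theorem hasSmallGenerators_suppGroupNorm : HasSmallGenerators suppGroupNorm ⊤ := by
  intro ε hε
  obtain ⟨M, hM⟩ := exists_pow_lt_of_lt_one hε (one_half_lt_one (α := ℝ))
  refine ⟨_, fun e he k => ?_, closure_dyadicUnit_eq_top M⟩
  obtain ⟨m, hm, t, rfl⟩ := mem_iUnion₂.1 he
  rcases eq_or_ne k 0 with rfl | hk
  · rwa [zero_zsmul, map_zero]
  · calc suppNorm (k • dyadicUnit m t) = (1 / 2) ^ m := by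
          rw [suppNorm_zsmul_dyadicUnit t hk, one_div_pow]
      _ ≤ (1 / 2) ^ M := pow_le_pow_of_le_one (by norm_num) (by norm_num) hm
      _ < ε := hM

theorem exists_dyadicIndex_eq_and_alternating_succ_eq (m : ℕ) (t : Fin (2 ^ m)) (c : Fin 2) :
    ∃ x, dyadicIndex m x = t ∧ (alternating (m + 1)).1 x = 1 - (c : ℤ) := by
  have hlt : 2 * (t : ℕ) + c < 2 ^ (m + 1) := by
    rw [pow_succ]
    omega
  refine ⟨dyadicPoint (m + 1) ⟨_, hlt⟩, Fin.ext ?_, ?_⟩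
  · rw [← dyadicIndex_add_div m 1, dyadicIndex_dyadicPoint]
    dsimp only
    omega
  · rw [alternating_apply, dyadicIndex_dyadicPoint]
    fin_cases c <;> simp

theorem exists_apply_add_zsmul_alternating_ne_zero {m : ℕ} {w : DyadicStep}
    (hw : w ∈ dyadicLevel m) {a : ℤ} (ha : a ≠ 0) (t : Fin (2 ^ m)) :
    ∃ x, dyadicIndex m x = t ∧ (w + a • alternating (m + 1)).1 x ≠ 0 := by
  obtain ⟨x, hxt, hx⟩ := exists_dyadicIndex_eq_and_alternating_succ_eq m t 0
  obtain ⟨y, hyt, hy⟩ := exists_dyadicIndex_eq_and_alternating_succ_eq m t 1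
  by_contra! hzero
  have hx0 : w.1 x + (a • alternating (m + 1)).1 x = 0 := hzero x hxt
  have hy0 : w.1 y + (a • alternating (m + 1)).1 y = 0 := hzero y hyt
  have hxy : w.1 x = w.1 y := hw (hxt.trans hyt.symm)
  rw [DyadicStep.zsmul_apply, hx] at hx0
  rw [DyadicStep.zsmul_apply, hy] at hy0
  simp only [Fin.val_zero, Fin.val_one, Nat.cast_zero, Nat.cast_one, sub_zero, sub_self, mul_one,
    mul_zero, add_zero] at hx0 hy0
  omega

theorem one_half_le_suppNorm_add_zsmul_alternating {m : ℕ} {w : DyadicStep}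
    (hw : w ∈ dyadicLevel m) {a : ℤ} (ha : a ≠ 0) :
    1 / 2 ≤ suppNorm (w + a • alternating (m + 1)) := by
  set v := w + a • alternating (m + 1)
  have hv : v ∈ dyadicLevel (m + 1) :=
    add_mem (dyadicLevel_mono m.le_succ hw) (zsmul_mem (alternating_mem_dyadicLevel _) _)
  set F := Finset.univ.filter fun t => v.1 (dyadicPoint (m + 1) t) ≠ 0
  have hsurj : SurjOn (fun t => dyadicIndex m (dyadicPoint (m + 1) t)) F
      (Finset.univ : Finset (Fin (2 ^ m))) := by
    intro t _
    obtain ⟨x, rfl, hx⟩ := exists_apply_add_zsmul_alternating_ne_zero hw ha t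
    refine ⟨dyadicIndex (m + 1) x, ?_, ?_⟩
    · rwa [Finset.mem_coe, Finset.mem_filter_univ, apply_dyadicPoint_dyadicIndex hv]
    · exact dyadicIndex_eq_of_le m.le_succ (dyadicIndex_dyadicPoint _ _)
  have hcard : 2 ^ m ≤ F.card := by
    simpa using Finset.card_le_card_of_surjOn _ hsurj
  calc (1 : ℝ) / 2 = 2 ^ m / 2 ^ (m + 1) := by field_simp; ring
    _ ≤ F.card / 2 ^ (m + 1) := by gcongr; exact_mod_cast hcard
    _ = suppNorm v := (suppNorm_eq_card_div hv).symm

theorem one_half_le_suppNorm_sub_linearCombination {ι : Type*} {ρ : ι → ℕ}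
    (hρ : Function.Injective ρ) {M : ℕ} {h : DyadicStep} (hh : h ∈ dyadicLevel M) {β : ι →₀ ℤ}
    {i : ι} (hi : β i ≠ 0) (hM : M < ρ i) :
    1 / 2 ≤ suppNorm (h - Finsupp.linearCombination ℤ (fun j => alternating (ρ j)) β) := by
  classical
  obtain ⟨q, hq, hmax⟩ := β.support.exists_max_image ρ ⟨i, Finsupp.mem_support_iff.2 hi⟩
  have hMq : M < ρ q := hM.trans_le (hmax i (Finsupp.mem_support_iff.2 hi))
  obtain ⟨m, hm⟩ : ∃ m, ρ q = m + 1 := Nat.exists_eq_succ_of_ne_zero hMq.ne_bot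
  have hrest : Finsupp.linearCombination ℤ (fun j => alternating (ρ j)) (β.erase q) ∈
      dyadicLevel m := by
    refine sum_mem fun j hj => zsmul_mem (dyadicLevel_mono ?_ (alternating_mem_dyadicLevel _)) _
    rw [Finsupp.support_erase, Finset.mem_erase] at hj
    have hjq : ρ j < ρ q := (hmax j hj.2).lt_of_ne (hρ.ne hj.1)
    omega
  rw [← Finsupp.single_add_erase q β, map_add, Finsupp.linearCombination_single, hm,
    add_comm, ← sub_sub, sub_eq_add_neg _ (β q • _), ← neg_zsmul]
  exact one_half_le_suppNorm_add_zsmul_alternating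
    (sub_mem (dyadicLevel_mono (by omega) hh) hrest) (neg_ne_zero.2 (Finsupp.mem_support_iff.1 hq))

end DyadicStep

section CostSeminorm

variable {A : Type u} [AddCommGroup A] {S : Set A} {ν : A → ℝ}

/-- The costs `∑ |α i| * ν (s i)` of the representations `x = ∑ α i • s i` with `s i ∈ S`. -/
def representationCosts (S : Set A) (ν : A → ℝ) (x : A) : Set ℝ :=
  {c | ∃ (k : ℕ) (s : Fin k → A) (α : Fin k → ℤ),
    (∀ i, s i ∈ S) ∧ x = ∑ i, α i • s i ∧ c = ∑ i, |(α i : ℝ)| * ν (s i)}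

theorem zero_mem_representationCosts : 0 ∈ representationCosts S ν 0 :=
  ⟨0, Fin.elim0, Fin.elim0, fun i => i.elim0, by simp, by simp⟩

theorem apply_mem_representationCosts {s : A} (hs : s ∈ S) : ν s ∈ representationCosts S ν s :=
  ⟨1, fun _ => s, fun _ => 1, fun _ => hs, by simp, by simp⟩

theorem neg_mem_representationCosts {x : A} {c : ℝ} (hc : c ∈ representationCosts S ν x) :
    c ∈ representationCosts S ν (-x) := by
  obtain ⟨k, s, α, hs, rfl, rfl⟩ := hc
  exact ⟨k, s, -α, hs, by simp, by simp⟩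

theorem add_mem_representationCosts {x y : A} {c d : ℝ} (hc : c ∈ representationCosts S ν x)
    (hd : d ∈ representationCosts S ν y) : c + d ∈ representationCosts S ν (x + y) := by
  obtain ⟨k, s, α, hs, rfl, rfl⟩ := hc
  obtain ⟨l, s', α', hs', rfl, rfl⟩ := hd
  refine ⟨k + l, Fin.append s s', Fin.append α α', ?_, by simp [Fin.sum_univ_add],
    by simp [Fin.sum_univ_add]⟩
  exact Fin.addCases (by simpa using hs) (by simpa using hs')

theorem representationCosts_nonempty (hS : AddSubgroup.closure S = ⊤) (x : A) :
    (representationCosts S ν x).Nonempty := by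
  induction hS ▸ AddSubgroup.mem_top x using AddSubgroup.closure_induction with
  | mem s hs => exact ⟨_, apply_mem_representationCosts hs⟩
  | zero => exact ⟨_, zero_mem_representationCosts⟩
  | add x y _ _ hx hy =>
    obtain ⟨⟨c, hc⟩, d, hd⟩ := And.intro hx hy
    exact ⟨_, add_mem_representationCosts hc hd⟩
  | neg x _ hx => exact hx.imp fun c hc => neg_mem_representationCosts hc

theorem representationCosts_induction {P : A → ℝ → Prop} (zero : P 0 0)
    (add : ∀ {x y c d}, P x c → P y d → P (x + y) (c + d))
    (zsmul : ∀ s ∈ S, ∀ a : ℤ, P (a • s) (|(a : ℝ)| * ν s)) {x : A} {c : ℝ}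
    (hc : c ∈ representationCosts S ν x) : P x c := by
  obtain ⟨k, s, α, hs, rfl, rfl⟩ := hc
  have key (F : Finset (Fin k)) : P (∑ i ∈ F, α i • s i) (∑ i ∈ F, |(α i : ℝ)| * ν (s i)) := by
    induction F using Finset.cons_induction with
    | empty => simpa using zero
    | cons i F hi ih =>
      rw [Finset.sum_cons, Finset.sum_cons]
      exact add (zsmul _ (hs i) _) ih
  exact key _

theorem map_zsmul_le_abs_mul (p : AddGroupSeminorm A) (a : ℤ) (x : A) :
    p (a • x) ≤ |(a : ℝ)| * p x := by
  let _ : SeminormedAddCommGroup A := p.toSeminormedAddCommGroup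
  change ‖a • x‖ ≤ |(a : ℝ)| * ‖x‖
  simpa only [Int.norm_eq_abs] using norm_zsmul_le a x

theorem le_of_mem_representationCosts {p : AddGroupSeminorm A} (hp : ∀ s ∈ S, p s ≤ ν s) {x : A}
    {c : ℝ} (hc : c ∈ representationCosts S ν x) : p x ≤ c := by
  refine representationCosts_induction (P := fun x c => p x ≤ c) (map_zero p).le
    (fun hx hy => (map_add_le_add p _ _).trans (add_le_add hx hy)) (fun s hs a => ?_) hc
  exact (map_zsmul_le_abs_mul p a s).trans (by gcongr; exact hp s hs)

/-- The largest seminorm that is at most `ν` on the generating set `S`. -/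
noncomputable def costSeminorm (hS : AddSubgroup.closure S = ⊤) (hν : ∀ s ∈ S, 0 ≤ ν s) :
    AddGroupSeminorm A where
  toFun x := sInf (representationCosts S ν x)
  map_zero' := le_antisymm
    (csInf_le ⟨0, fun _ => le_of_mem_representationCosts (p := 0) hν⟩ zero_mem_representationCosts)
    (Real.sInf_nonneg fun _ => le_of_mem_representationCosts (p := 0) hν)
  add_le' x y := by
    have hbdd (x : A) : BddBelow (representationCosts S ν x) :=
      ⟨0, fun _ => le_of_mem_representationCosts (p := 0) hν⟩
    rw [← csInf_add (representationCosts_nonempty hS x) (hbdd x)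
      (representationCosts_nonempty hS y) (hbdd y)]
    refine csInf_le_csInf (hbdd _)
      ((representationCosts_nonempty hS x).add (representationCosts_nonempty hS y)) ?_
    exact add_subset_iff.2 fun c hc d hd => add_mem_representationCosts hc hd
  neg' x := congrArg sInf <| Subset.antisymm
    (fun c hc => neg_neg x ▸ neg_mem_representationCosts hc) fun c => neg_mem_representationCosts

theorem costSeminorm_le {hS : AddSubgroup.closure S = ⊤} {hν : ∀ s ∈ S, 0 ≤ ν s} {s : A}
    (hs : s ∈ S) : costSeminorm hS hν s ≤ ν s :=
  csInf_le ⟨0, fun _ => le_of_mem_representationCosts (p := 0) hν⟩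
    (apply_mem_representationCosts hs)

theorem le_costSeminorm {hS : AddSubgroup.closure S = ⊤} {hν : ∀ s ∈ S, 0 ≤ ν s}
    {p : AddGroupSeminorm A} (hp : ∀ s ∈ S, p s ≤ ν s) : p ≤ costSeminorm hS hν :=
  fun x => le_csInf (representationCosts_nonempty hS x) fun _ => le_of_mem_representationCosts hp

theorem exists_mem_representationCosts_lt {hS : AddSubgroup.closure S = ⊤} {hν : ∀ s ∈ S, 0 ≤ ν s}
    {x : A} {δ : ℝ} (h : costSeminorm hS hν x < δ) : ∃ c ∈ representationCosts S ν x, c < δ :=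
  exists_lt_of_csInf_lt (representationCosts_nonempty hS x) h

end CostSeminorm

section ReducedCost

variable {G : Type u} [AddCommGroup G] {ι : Type*} {N : AddGroupNorm G} {ρ : ι → ℕ} {γ : ι → G}

/-- The cost `∑ |β i| * N (γ i)` of the combination `∑ β i • γ i`. -/
def combinationCost (N : AddGroupNorm G) (γ : ι → G) (β : ι →₀ ℤ) : ℝ :=
  β.sum fun i a => |(a : ℝ)| * N (γ i)

theorem combinationCost_eq_sum {β : ι →₀ ℤ} {P : Finset ι} (hP : β.support ⊆ P) :
    combinationCost N γ β = ∑ i ∈ P, |(β i : ℝ)| * N (γ i) :=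
  Finsupp.sum_of_support_subset _ hP _ (by simp)

theorem combinationCost_nonneg (β : ι →₀ ℤ) : 0 ≤ combinationCost N γ β :=
  Finset.sum_nonneg fun _ _ => mul_nonneg (abs_nonneg _) (apply_nonneg N _)

theorem combinationCost_add_le (β β' : ι →₀ ℤ) :
    combinationCost N γ (β + β') ≤ combinationCost N γ β + combinationCost N γ β' := by
  classical
  rw [combinationCost_eq_sum (P := β.support ∪ β'.support) Finsupp.support_add,
    combinationCost_eq_sum (P := β.support ∪ β'.support) Finset.subset_union_left,
    combinationCost_eq_sum (P := β.support ∪ β'.support) Finset.subset_union_right,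
    ← Finset.sum_add_distrib]
  refine Finset.sum_le_sum fun i _ => ?_
  rw [← add_mul, Finsupp.add_apply, Int.cast_add]
  exact mul_le_mul_of_nonneg_right (abs_add_le _ _) (apply_nonneg N _)

theorem abs_mul_le_combinationCost (β : ι →₀ ℤ) (i : ι) :
    |(β i : ℝ)| * N (γ i) ≤ combinationCost N γ β := by
  classical
  rw [combinationCost_eq_sum (Finset.subset_insert i β.support)]
  exact Finset.single_le_sum (f := fun i => |(β i : ℝ)| * N (γ i))
    (fun _ _ => mul_nonneg (abs_nonneg _) (apply_nonneg N _)) (Finset.mem_insert_self _ _)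

theorem apply_le_combinationCost {β : ι →₀ ℤ} {i : ι} (hi : β i ≠ 0) :
    N (γ i) ≤ combinationCost N γ β :=
  (le_mul_of_one_le_left (apply_nonneg N _) (by exact_mod_cast Int.one_le_abs hi)).trans
    (abs_mul_le_combinationCost β i)

theorem finite_setOf_combinationCost_le (hγ : ∀ i, γ i ≠ 0) {P : Set ι} (hP : P.Finite) (C : ℝ) :
    {β : ι →₀ ℤ | (∀ i, β i ≠ 0 → i ∈ P) ∧ combinationCost N γ β ≤ C}.Finite := by
  classical
  set b : ι →₀ ℤ := Finsupp.indicator hP.toFinset fun i _ => ⌊C / N (γ i)⌋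
  refine (finite_Icc (-b) b).subset fun β ⟨hβP, hβC⟩ => ?_
  have hβb : ∀ i, |β i| ≤ b i := fun i => by
    by_cases hi : i ∈ hP.toFinset
    · rw [Finsupp.indicator_of_mem hi, Int.le_floor, Int.cast_abs,
        le_div_iff₀ (map_pos_of_ne_zero N (hγ i))]
      exact (abs_mul_le_combinationCost β i).trans hβC
    · rw [Finsupp.indicator_of_notMem hi, of_not_not (mt (hβP i) (mt hP.mem_toFinset.2 hi)),
        abs_zero]
  exact ⟨fun i => (abs_le.1 (hβb i)).1, fun i => (abs_le.1 (hβb i)).2⟩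

/-- Some representation `x = (h, 0) + ∑ β i • (f_{ρ i}, γ i)` costs at most `c`, where `h` costs
`suppNorm h`: all multiples of dyadic units are merged into the single step function `h`. -/
def HasReducedCost (N : AddGroupNorm G) (ρ : ι → ℕ) (γ : ι → G) (x : DyadicStep × G) (c : ℝ) :
    Prop :=
  ∃ β : ι →₀ ℤ, x.2 = Finsupp.linearCombination ℤ γ β ∧
    suppNorm (x.1 - Finsupp.linearCombination ℤ (fun i => alternating (ρ i)) β) +
      combinationCost N γ β ≤ c

theorem HasReducedCost.of_suppNorm_le {h : DyadicStep} {c : ℝ} (hc : suppNorm h ≤ c) :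
    HasReducedCost N ρ γ (h, 0) c :=
  ⟨0, (map_zero _).symm, by simpa [combinationCost] using hc⟩

theorem HasReducedCost.zsmul_generator (i : ι) (a : ℤ) :
    HasReducedCost N ρ γ (a • (alternating (ρ i), γ i)) (|(a : ℝ)| * N (γ i)) :=
  ⟨Finsupp.single i a, by simp, by simp [combinationCost, suppNorm_eq_zero.2]⟩

theorem HasReducedCost.add {x y : DyadicStep × G} {c d : ℝ} (hx : HasReducedCost N ρ γ x c)
    (hy : HasReducedCost N ρ γ y d) : HasReducedCost N ρ γ (x + y) (c + d) := by
  obtain ⟨β, hβ, hc⟩ := hx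
  obtain ⟨β', hβ', hd⟩ := hy
  refine ⟨β + β', by rw [map_add, Prod.snd_add, hβ, hβ'], ?_⟩
  rw [map_add, Prod.fst_add, add_sub_add_comm]
  linarith [suppNorm_add_le (x.1 - Finsupp.linearCombination ℤ (fun i => alternating (ρ i)) β)
    (y.1 - Finsupp.linearCombination ℤ (fun i => alternating (ρ i)) β'),
    combinationCost_add_le (N := N) (γ := γ) β β']

theorem le_of_suppNorm_sub_linearCombination_add_lt (hρ : Function.Injective ρ) {M : ℕ}
    {h : DyadicStep} (hh : h ∈ dyadicLevel M) {β : ι →₀ ℤ}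
    (hlt : suppNorm (h - Finsupp.linearCombination ℤ (fun i => alternating (ρ i)) β) +
      combinationCost N γ β < 1 / 2) {i : ι} (hi : β i ≠ 0) : ρ i ≤ M := by
  by_contra! hM
  linarith [one_half_le_suppNorm_sub_linearCombination hρ hh hi hM,
    combinationCost_nonneg (N := N) (γ := γ) β]

theorem HasReducedCost.exists_pos_forall_lt (hρ : Function.Injective ρ) (hγ : ∀ i, γ i ≠ 0)
    (x : DyadicStep × G) :
    ∃ δ > 0, ∀ c < δ, HasReducedCost N ρ γ x c → x.2 = 0 ∧ suppNorm x.1 ≤ c := by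
  obtain ⟨M, hM⟩ := x.1.exists_mem_dyadicLevel
  have hfin : {i | ρ i ≤ M}.Finite := (finite_Iic M).preimage hρ.injOn
  obtain ⟨δ, hδ, hδγ⟩ : ∃ δ > 0, ∀ i, ρ i ≤ M → δ ≤ N (γ i) :=
    ((eventually_mem_nhdsWithin (s := Ioi (0 : ℝ))).and <| nhdsWithin_le_nhds <|
      (Filter.eventually_all_finite hfin).2
        fun i _ => eventually_le_nhds (map_pos_of_ne_zero N (hγ i))).exists
  refine ⟨min δ (1 / 2), by positivity, fun c hc ⟨β, hβ, hβc⟩ => ?_⟩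
  obtain ⟨hcδ, hc2⟩ := lt_min_iff.1 hc
  obtain rfl : β = 0 := by
    by_contra! hβ0
    obtain ⟨i, hi⟩ := Finsupp.ne_iff.1 hβ0
    have hiM := le_of_suppNorm_sub_linearCombination_add_lt hρ hM (hβc.trans_lt hc2) hi
    linarith [hδγ i hiM, apply_le_combinationCost (N := N) (γ := γ) hi, suppNorm_nonneg
      (x.1 - Finsupp.linearCombination ℤ (fun i => alternating (ρ i)) β)]
  exact ⟨by simpa using hβ, by simpa [combinationCost] using hβc⟩

theorem snd_eq_zero_of_forall_hasReducedCost_zsmul [IsAddTorsionFree G]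
    (hρ : Function.Injective ρ) (hγ : ∀ i, γ i ≠ 0) {x : DyadicStep × G}
    (hx : ∀ k : ℤ, ∃ c < 1 / 2, HasReducedCost N ρ γ (k • x) c) : x.2 = 0 := by
  choose c hc β hβ hβc using hx
  obtain ⟨M, hM⟩ := x.1.exists_mem_dyadicLevel
  have hfin := finite_setOf_combinationCost_le (N := N) hγ ((finite_Iic M).preimage hρ.injOn)
    (1 / 2)
  have hrange : range β ⊆ {β | (∀ i, β i ≠ 0 → i ∈ ρ ⁻¹' Iic M) ∧
      combinationCost N γ β ≤ 1 / 2} := by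
    rintro _ ⟨k, rfl⟩
    have hlt := (hβc k).trans_lt (hc k)
    refine ⟨fun i hi => le_of_suppNorm_sub_linearCombination_add_lt hρ (zsmul_mem hM k) hlt hi, ?_⟩
    exact (le_add_of_nonneg_left (suppNorm_nonneg _)).trans hlt.le
  by_contra! hx0
  have hinj : Function.Injective fun k : ℤ => k • x.2 :=
    injective_zsmul_iff_not_isOfFinAddOrder.2 (not_isOfFinAddOrder_of_isAddTorsionFree hx0)
  have hβinj : Function.Injective β := fun k l hkl => hinj <| by
    simpa only [← hβ, Prod.smul_snd] using congrArg (Finsupp.linearCombination ℤ γ) hkl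
  exact infinite_range_of_injective hβinj (hfin.subset hrange)

end ReducedCost

section GeneratedNorm

variable {G : Type u} [AddCommGroup G] {N : AddGroupNorm G} {g : ℤ → ℕ → G} {r : ℤ → ℕ → ℕ}

theorem exists_isListing [Countable G] (h : ∀ ε > 0, ∃ x, x ≠ 0 ∧ N x < ε) :
    ∃ g r, IsListing N g r := by
  have hlist : ∀ m : ℤ, ∃ g : ℕ → G, {x : G | x ≠ 0 ∧ N x ≤ (2 : ℝ) ^ (-m)} = range g := fun m =>
    let ⟨x, hx, hxm⟩ := h ((2 : ℝ) ^ (-m)) (by positivity)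
    (to_countable _).exists_eq_range ⟨x, hx, hxm.le⟩
  choose g hg using hlist
  obtain ⟨f, hf⟩ := exists_injective_nat (ℤ × ℕ)
  exact ⟨g, fun m t => f (m, t), fun m => (hg m).symm, hf⟩

theorem IsListing.ne_zero (hl : IsListing N g r) (m : ℤ) (t : ℕ) : g m t ≠ 0 := by
  have hmem : g m t ∈ {x : G | x ≠ 0 ∧ N x ≤ (2 : ℝ) ^ (-m)} := hl.range_eq m ▸ mem_range_self t
  exact hmem.1

theorem IsListing.exists_eq (hl : IsListing N g r) {x : G} (hx : x ≠ 0) : ∃ m t, g m t = x := by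
  obtain ⟨k, hk⟩ := pow_unbounded_of_one_lt (N x) (one_lt_two : (1 : ℝ) < 2)
  have hmem : x ∈ range (g (-k)) := by
    rw [hl.range_eq]
    exact ⟨hx, by simpa using hk.le⟩
  exact ⟨_, hmem⟩

theorem closure_genSet (hl : IsListing N g r) : AddSubgroup.closure (genSet g r) = ⊤ := by
  have hle : (⊤ : AddSubgroup DyadicStep) ≤
      (AddSubgroup.closure (genSet g r)).comap (AddMonoidHom.inl DyadicStep G) := by
    rw [← closure_dyadicUnit_eq_top 0, AddSubgroup.closure_le]
    refine iUnion₂_subset fun m _ => range_subset_iff.2 fun t => ?_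
    exact AddSubgroup.subset_closure (Or.inl ⟨m, t, 1, one_ne_zero, by simp⟩)
  have hfst (h : DyadicStep) : (h, 0) ∈ AddSubgroup.closure (genSet g r) :=
    hle (AddSubgroup.mem_top h)
  refine (AddSubgroup.eq_top_iff' _).2 fun ⟨h, x⟩ => ?_
  rcases eq_or_ne x 0 with rfl | hx
  · exact hfst h
  · obtain ⟨m, t, rfl⟩ := hl.exists_eq hx
    have hgen : (alternating (r m t), g m t) ∈ AddSubgroup.closure (genSet g r) :=
      AddSubgroup.subset_closure (Or.inr ⟨m, t, rfl⟩)
    simpa using add_mem (hfst (h - alternating (r m t))) hgen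

theorem provNorm_mk_zero (h : DyadicStep) : provNorm N (h, 0) = suppNorm h :=
  if_pos rfl

theorem IsListing.provNorm_eq (hl : IsListing N g r) (m : ℤ) (t : ℕ) :
    provNorm N (alternating (r m t), g m t) = N (g m t) :=
  if_neg (hl.ne_zero m t)

theorem ne_zero_and_provNorm_pos_of_mem_genSet (hl : IsListing N g r) {s : DyadicStep × G}
    (hs : s ∈ genSet g r) : s ≠ 0 ∧ 0 < provNorm N s := by
  rcases hs with ⟨m, t, p, hp, rfl⟩ | ⟨m, t, rfl⟩
  · have hpos : 0 < suppNorm (p • dyadicUnit m t) := by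
      rw [suppNorm_zsmul_dyadicUnit t hp]
      positivity
    exact ⟨fun h0 => hpos.ne' (suppNorm_eq_zero.2 (congrArg Prod.fst h0)),
      provNorm_mk_zero (N := N) _ ▸ hpos⟩
  · exact ⟨fun h0 => hl.ne_zero m t (congrArg Prod.snd h0),
      hl.provNorm_eq m t ▸ map_pos_of_ne_zero N (hl.ne_zero m t)⟩

/-- The norm `(*)` before its definiteness is known. -/
noncomputable def generatedSeminorm (hl : IsListing N g r) : AddGroupSeminorm (DyadicStep × G) :=
  costSeminorm (closure_genSet hl) fun _ hs => (ne_zero_and_provNorm_pos_of_mem_genSet hl hs).2.le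

theorem hasReducedCost_zsmul_of_mem_genSet (hl : IsListing N g r) {s : DyadicStep × G}
    (hs : s ∈ genSet g r) (a : ℤ) : HasReducedCost N (fun p : ℤ × ℕ => r p.1 p.2)
      (fun p => g p.1 p.2) (a • s) (|(a : ℝ)| * provNorm N s) := by
  rcases hs with ⟨m, t, p, -, rfl⟩ | ⟨m, t, rfl⟩
  · rw [provNorm_mk_zero, Prod.smul_mk, smul_zero]
    exact .of_suppNorm_le (map_zsmul_le_abs_mul suppGroupNorm.toAddGroupSeminorm a _)
  · rw [hl.provNorm_eq]
    exact .zsmul_generator (ρ := fun p : ℤ × ℕ => r p.1 p.2) (γ := fun p => g p.1 p.2) (m, t) a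

theorem exists_hasReducedCost_of_generatedSeminorm_lt (hl : IsListing N g r) {x : DyadicStep × G}
    {δ : ℝ} (hx : generatedSeminorm hl x < δ) : ∃ c < δ,
      HasReducedCost N (fun p : ℤ × ℕ => r p.1 p.2) (fun p => g p.1 p.2) x c := by
  obtain ⟨c, hc, hcδ⟩ := exists_mem_representationCosts_lt hx
  exact ⟨c, hcδ, representationCosts_induction (.of_suppNorm_le (suppNorm_eq_zero.2 rfl).le)
    .add (fun s hs => hasReducedCost_zsmul_of_mem_genSet hl hs) hc⟩

theorem eq_zero_of_generatedSeminorm_eq_zero (hl : IsListing N g r) {x : DyadicStep × G}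
    (hx : generatedSeminorm hl x = 0) : x = 0 := by
  obtain ⟨δ, hδ, hsmall⟩ := HasReducedCost.exists_pos_forall_lt (N := N) (γ := fun p => g p.1 p.2)
    hl.injective (fun p => hl.ne_zero p.1 p.2) x
  have hreduced {ε : ℝ} (hε : 0 < ε) : x.2 = 0 ∧ suppNorm x.1 < ε := by
    obtain ⟨c, hc, hxc⟩ := exists_hasReducedCost_of_generatedSeminorm_lt hl
      (hx.trans_lt (lt_min hδ hε))
    obtain ⟨hcδ, hcε⟩ := lt_min_iff.1 hc
    exact (hsmall c hcδ hxc).imp_right fun h => h.trans_lt hcε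
  refine Prod.ext (suppNorm_eq_zero.1 ?_) (hreduced one_pos).1
  exact le_antisymm (le_of_forall_pos_le_add fun ε hε => by
    simpa using (hreduced hε).2.le) (suppNorm_nonneg _)

/-- The norm `(*)` on `H ⊕ G`. -/
noncomputable def generatedGroupNorm (hl : IsListing N g r) : AddGroupNorm (DyadicStep × G) where
  __ := generatedSeminorm hl
  toFun := generatedNorm N g r
  eq_zero_of_map_eq_zero' _ := eq_zero_of_generatedSeminorm_eq_zero hl

theorem generatedGroupNorm_le_provNorm (hl : IsListing N g r) {s : DyadicStep × G}
    (hs : s ∈ genSet g r) : generatedGroupNorm hl s ≤ provNorm N s :=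
  costSeminorm_le (hS := closure_genSet hl)
    (hν := fun _ hs => (ne_zero_and_provNorm_pos_of_mem_genSet hl hs).2.le) hs

theorem generatedGroupNorm_inl_le (hl : IsListing N g r) (h : DyadicStep) :
    generatedGroupNorm hl (AddMonoidHom.inl _ _ h) ≤ suppNorm h := by
  refine le_suppNorm_of_forall_zsmul_dyadicUnit
    (p := (generatedSeminorm hl).comp (AddMonoidHom.inl _ _)) (fun m t k hk => ?_) h
  exact (generatedGroupNorm_le_provNorm hl (Or.inl ⟨m, t, k, hk, rfl⟩)).trans_eq
    (provNorm_mk_zero _)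

theorem apply_snd_le_generatedGroupNorm (hl : IsListing N g r) (x : DyadicStep × G) :
    N x.2 ≤ generatedGroupNorm hl x := by
  refine le_costSeminorm (hS := closure_genSet hl)
    (hν := fun _ hs => (ne_zero_and_provNorm_pos_of_mem_genSet hl hs).2.le)
    (p := N.toAddGroupSeminorm.comp (AddMonoidHom.snd _ _)) ?_ x
  rintro _ (⟨m, t, p, -, rfl⟩ | ⟨m, t, rfl⟩)
  · exact (map_zero N).trans_le ((provNorm_mk_zero (N := N) _).symm ▸ suppNorm_nonneg _)
  · exact (hl.provNorm_eq m t).ge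

theorem normSSGP_succ_generatedGroupNorm_iff [IsAddTorsionFree G] (hl : IsListing N g r) {n : ℕ} :
    NormSSGP (n + 1) (generatedGroupNorm hl) ↔ NormSSGP n N := by
  constructor
  · refine NormSSGP.of_small_zmultiples (π := AddMonoidHom.snd _ _) Prod.snd_surjective
      (apply_snd_le_generatedGroupNorm hl) one_half_pos fun x hx => ?_
    exact snd_eq_zero_of_forall_hasReducedCost_zsmul hl.injective (fun p => hl.ne_zero p.1 p.2)
      fun k => exists_hasReducedCost_of_generatedSeminorm_lt hl (hx k)
  · refine NormSSGP.succ_of_hasSmallGenerators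
      (hasSmallGenerators_suppGroupNorm.map (generatedGroupNorm_inl_le hl))
      (ι := AddMonoidHom.inr _ _) ?_ fun y => ?_
    · refine (AddSubgroup.eq_top_iff' _).2 fun ⟨h, y⟩ => AddSubgroup.mem_sup.2 ?_
      exact ⟨(h, 0), ⟨h, trivial, rfl⟩, (0, y), ⟨y, rfl⟩, by simp⟩
    · rcases eq_or_ne y 0 with rfl | hy
      · exact ⟨0, zero_mem _, by rw [map_zero, add_zero, map_zero, map_zero]⟩
      · obtain ⟨m, t, rfl⟩ := hl.exists_eq hy
        refine ⟨(alternating (r m t), 0), ⟨_, trivial, rfl⟩, ?_⟩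
        simpa [hl.provNorm_eq] using generatedGroupNorm_le_provNorm hl (Or.inr ⟨m, t, rfl⟩)

end GeneratedNorm

theorem normSSGP_one_suppGroupNorm : NormSSGP 1 suppGroupNorm :=
  NormSSGP.succ_of_hasSmallGenerators hasSmallGenerators_suppGroupNorm
    (N := normAddGroupNorm PUnit.{1}) (ι := 0) (top_sup_eq _)
    (fun _ => ⟨0, zero_mem _, by simp⟩) (inferInstanceAs (Subsingleton PUnit))

section Stages

variable {G : Type} [AddCommGroup G] {N : AddGroupNorm G}

theorem IsStage.countable {n : ℕ} (h : IsStage n N) : Countable G := by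
  induction h with
  | base => infer_instance
  | step => infer_instance

theorem IsStage.isAddTorsionFree {n : ℕ} (h : IsStage n N) : IsAddTorsionFree G := by
  induction h with
  | base => infer_instance
  | step => infer_instance

theorem IsStage.normSSGP_iff {n k : ℕ} (h : IsStage n N) : NormSSGP k N ↔ n ≤ k := by
  induction h generalizing k with
  | base N hN =>
    obtain rfl : N = suppGroupNorm := DFunLike.ext _ _ hN
    refine ⟨fun h1 => Nat.one_le_iff_ne_zero.2 ?_, fun hk => normSSGP_one_suppGroupNorm.mono hk⟩
    rintro rfl
    exact not_normSSGP_zero _ h1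
  | step n N hN g r hl N' hN' ih =>
    obtain rfl : N' = generatedGroupNorm hl := DFunLike.ext _ _ hN'
    have := hN.isAddTorsionFree
    cases k with
    | zero => simpa using not_normSSGP_zero _
    | succ k => rw [normSSGP_succ_generatedGroupNorm_iff, ih, Nat.succ_le_succ_iff]

theorem IsStage.exists_succ {n : ℕ} (h : IsStage (n + 1) N) :
    ∃ N' : AddGroupNorm (DyadicStep × G), IsStage (n + 2) N' := by
  have := h.countable
  obtain ⟨g, r, hl⟩ := exists_isListing fun ε hε =>
    (h.normSSGP_iff.2 le_rfl).exists_ne_zero_lt (mt h.normSSGP_iff.1 n.lt_irrefl) hε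
  exact ⟨generatedGroupNorm hl, .step _ N h g r hl _ fun _ => rfl⟩

theorem exists_isStage {n : ℕ} (hn : 1 ≤ n) :
    ∃ (G : Type) (_ : AddCommGroup G) (N : AddGroupNorm G), IsStage n N := by
  induction n, hn using Nat.le_induction with
  | base => exact ⟨_, _, suppGroupNorm, .base _ fun _ => rfl⟩
  | succ n hn ih =>
    obtain ⟨G, _, N, hN⟩ := ih
    obtain ⟨n, rfl⟩ := Nat.exists_eq_add_of_le' hn
    exact ⟨_, _, hN.exists_succ⟩

end Stages

theorem exists_ssgp_not_ssgp_pred {n : ℕ} (hn : 1 ≤ n) : ∃ (G : Type) (_ : CommGroup G)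
    (_ : TopologicalSpace G) (_ : IsTopologicalGroup G), T2Space G ∧
      TopologicalSpace.MetrizableSpace G ∧ Countable G ∧ IsMulTorsionFree G ∧
      SSGP n G ∧ ¬ SSGP (n - 1) G := by
  obtain ⟨G, _, N, hN⟩ := exists_isStage hn
  have := hN.countable
  have := hN.isAddTorsionFree
  let _ : NormedAddCommGroup G := N.toNormedAddCommGroup
  exact ⟨Multiplicative G, inferInstance, inferInstance, inferInstance,
    inferInstanceAs (T2Space G), inferInstanceAs (TopologicalSpace.MetrizableSpace G),
    inferInstanceAs (Countable G), inferInstance, hN.normSSGP_iff.2 le_rfl,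
    fun h => (Nat.sub_one_lt_of_lt hn).not_ge (hN.normSSGP_iff.1 h)⟩

theorem ssgp_ulift_iff {n : ℕ} {G : Type v} [Group G] [TopologicalSpace G] [IsTopologicalGroup G] :
    SSGP n (ULift.{u} G) ↔ SSGP n G := by
  let e : ULift.{u} G ≃* G := MulEquiv.ulift
  have hdown : Continuous e.toMonoidHom := continuous_uliftDown
  have hup : Continuous e.symm.toMonoidHom := continuous_uliftUp
  exact ⟨SSGP.of_surjective n hdown e.surjective, SSGP.of_surjective n hup e.symm.surjective⟩

theorem mainTheorem2 :
    -- for `n ≥ 1` there is an abelian group in `SSGP(n)` but not in `SSGP(n-1)`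
    (∀ n : ℕ, 1 ≤ n → ∃ (G : Type) (_ : CommGroup G) (_ : TopologicalSpace G)
      (_ : IsTopologicalGroup G), T2Space G ∧ TopologicalSpace.MetrizableSpace G ∧
        Countable G ∧ IsMulTorsionFree G ∧ SSGP n G ∧ ¬ SSGP (n - 1) G) ∧
    -- the inclusions `SSGP(n) ⊆ SSGP(n+1)` hold and are proper
    (∀ n : ℕ,
      (∀ (G : Type u) [Group G] [TopologicalSpace G] [IsTopologicalGroup G] [T2Space G],
        SSGP n G → SSGP (n + 1) G) ∧
      ∃ (G : Type u) (_ : Group G) (_ : TopologicalSpace G) (_ : IsTopologicalGroup G),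
        T2Space G ∧ SSGP (n + 1) G ∧ ¬ SSGP n G) ∧
    -- the group `H` from which the construction starts
    (Countable DyadicStep ∧ IsAddTorsionFree DyadicStep ∧ Nontrivial DyadicStep ∧
      ∃ N : AddGroupNorm DyadicStep, (∀ h, N h = suppNorm h) ∧ NormSSGP 1 N) ∧
    -- the inductive step, from `G = G_{n+1}` to `H ⊕ G = G_{n+2}`
    (∀ (n : ℕ) (G : Type u) [AddCommGroup G] (N : AddGroupNorm G),
      Countable G → IsAddTorsionFree G → NormSSGP (n + 1) N → ¬ NormSSGP n N →
      (∃ g r, IsListing N g r) ∧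
      ∀ g r, IsListing N g r →
        AddSubgroup.closure (genSet g r) = ⊤ ∧
        (∀ s ∈ genSet g r, s ≠ 0 ∧ 0 < provNorm N s) ∧
        Countable (DyadicStep × G) ∧ IsAddTorsionFree (DyadicStep × G) ∧
        ∃ N' : AddGroupNorm (DyadicStep × G), (∀ x, N' x = generatedNorm N g r x) ∧
          NormSSGP (n + 2) N' ∧ ¬ NormSSGP (n + 1) N') ∧
    -- the groups `G_n` exist for all `n ≥ 1` and have the asserted properties
    (∀ n : ℕ, 1 ≤ n →
      (∃ (G : Type) (_ : AddCommGroup G) (N : AddGroupNorm G), IsStage n N) ∧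
      ∀ (G : Type) [AddCommGroup G] (N : AddGroupNorm G), IsStage n N →
        Countable G ∧ IsAddTorsionFree G ∧ NormSSGP n N ∧ ¬ NormSSGP (n - 1) N) := by
  refine ⟨fun n => exists_ssgp_not_ssgp_pred, fun n => ⟨fun G _ _ _ _ => SSGP.succ n, ?_⟩,
    ⟨inferInstance, inferInstance, inferInstance, suppGroupNorm, fun _ => rfl,
      normSSGP_one_suppGroupNorm⟩,
    fun n G _ N _ _ h h' => ⟨exists_isListing fun ε => h.exists_ne_zero_lt h', fun g r hl => ?_⟩,
    fun n hn => ⟨exists_isStage hn, fun G _ N hN => ?_⟩⟩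
  · obtain ⟨G, _, _, _, _, -, -, -, hG, hG'⟩ := exists_ssgp_not_ssgp_pred n.succ_pos
    exact ⟨ULift.{u} G, inferInstance, inferInstance, inferInstance, inferInstance,
      ssgp_ulift_iff.2 hG, mt ssgp_ulift_iff.1 hG'⟩
  · exact ⟨closure_genSet hl, fun s => ne_zero_and_provNorm_pos_of_mem_genSet hl, inferInstance,
      inferInstance, generatedGroupNorm hl, fun _ => rfl,
      (normSSGP_succ_generatedGroupNorm_iff hl).2 h,
      mt (normSSGP_succ_generatedGroupNorm_iff hl).1 h'⟩
  · exact ⟨hN.countable, hN.isAddTorsionFree, hN.normSSGP_iff.2 le_rfl,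
      fun h => (Nat.sub_one_lt_of_lt hn).not_ge (hN.normSSGP_iff.1 h)⟩
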